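/- Let $d\ge 1$, let $X=\{1,\dots,d\}^{\mathbb N}$ be the full one-sided shift with shift map $\sigma$, and for a fixed $\theta\in(0,1)$ let $d_\theta(x,y)=\theta^{N}$, where $N\ge 1$ is the first position at which $x\ne y$ differ (and $d_\theta(x,x)=0$). Let $f:X\to\mathbb R$ be strictly positive and Lipschitz for $d_\theta$. Write $g^n(x)=\sum_{i=0}^{n-1} g(\sigma^i x)$, $\mathrm{Fix}_n=\{x:\sigma^n x=x\}$, let $P(g)$ be the topological pressure of a continuous $g$, i.e. $P(g)=\lim_n \frac1n\log\sum_{w\in\{1,\dots,d\}^n}\sup_{x\in[w]}e^{g^n(x)}$, and let $\beta(f)=\sup_\nu\int f\,d\nu$ over all $\sigma$-invariant Borel probability measures $\nu$. For $c>0$ and $s\in(0,1)$ let $\mu_{c,s}$ be the invariant probability measure on $X$ with $$\int k\,d\mu_{c,s}=\frac{\sum_{n=1}^{\infty}\sum_{x\in \mathrm{Fix}_n}e^{c s f^n(x)-nP(cf)}\,\frac{k^n(x)}{n}}{\sum_{n=1}^{\infty}\sum_{x\in \mathrm{Fix}_n}e^{c s f^n(x)-nP(cf)}}$$ for all continuous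 $k:X\to\mathbb R$. For a periodic point $x$ with minimal period $n_x$ put $I(x)=n_x\,\beta(f)-f^{n_x}(x)$. Let $c\to\infty$ and $s\to 1$ (along any sequence, net or filter) in such a way that, for some $L\in(0,\infty]$, either $c(1-s)\to L$ or, more generally, $\liminf c(1-s)=L$. Then for every cylinder $k=\{x: x_1=a_1,\dots,x_m=a_m\}$ (with $m\ge 0$), $$\frac1c\log\mu_{c,s}(k)\longrightarrow-\inf\{I(x): x\in k,\ x\ \text{periodic}\}.$$ -/

import Mathlib

open Filter Topology MeasureTheory

noncomputable section

namespace ZetaLDP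

/-- The full one-sided shift space on `d` symbols (coordinates indexed from `0`), with the product
topology and the product (equivalently Borel) sigma-algebra. -/
abbrev FullShift (d : ℕ) : Type := ℕ → Fin d

/-- The shift map. -/
def shift {d : ℕ} (x : FullShift d) : FullShift d := fun n => x (n + 1)

open Classical in
/-- The metric `d_θ(x, y) = θ ^ N`, where `N ≥ 1` is the position of the first symbol at which
`x` and `y` differ, the first symbol having position `1`. -/
def dTheta {d : ℕ} (θ : ℝ) (x y : FullShift d) : ℝ :=
  if x = y then 0 else θ ^ (PiNat.firstDiff x y + 1)

/-- Lipschitz functions for `d_θ`. -/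
def IsLipschitz {d : ℕ} (θ : ℝ) (f : FullShift d → ℝ) : Prop :=
  ∃ C : ℝ, ∀ x y, |f x - f y| ≤ C * dTheta θ x y

/-- The shift-invariant Borel probability measures. -/
def invariantProbabilities (d : ℕ) : Set (Measure (FullShift d)) :=
  {ν | IsProbabilityMeasure ν ∧ MeasurePreserving shift ν ν}

/-- The maximal ergodic average `β(f) = sup ∫ f dν` over invariant probabilities. -/
def maxAverage {d : ℕ} (f : FullShift d → ℝ) : ℝ :=
  sSup ((fun ν : Measure (FullShift d) => ∫ x, f x ∂ν) '' invariantProbabilities d)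

/-- The partition function `Z_n(g) = ∑_w sup_{x ∈ [w]} exp (g^n(x))`, the sum being over the words
`w` of length `n`. -/
def partitionFunction {d : ℕ} (g : FullShift d → ℝ) (n : ℕ) : ℝ :=
  ∑ w : Fin n → Fin d,
    sSup ((fun x => Real.exp (birkhoffSum shift g n x)) ''
      {x : FullShift d | ∀ i : Fin n, x i = w i})

/-- The topological pressure `P(g)`, the exponential growth rate of the partition functions. -/
def pressure {d : ℕ} (g : FullShift d → ℝ) : ℝ :=
  limsup (fun n : ℕ => (1 / (n : ℝ)) * Real.log (partitionFunction g n)) atTop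

/-- `Fix_n`, the set of solutions of `σ^n(x) = x`. -/
def Fix (d n : ℕ) : Set (FullShift d) := {x | Function.IsPeriodicPt shift n x}

/-- The weight `exp (c s f^n(x) - n P(c f))`. -/
def weight {d : ℕ} (f : FullShift d → ℝ) (c s : ℝ) (n : ℕ) (x : FullShift d) : ℝ :=
  Real.exp (c * s * birkhoffSum shift f n x - n * pressure (fun y => c * f y))

/-- The empirical measure `(1/n) (δ_x + δ_{σ x} + ⋯ + δ_{σ^{n-1} x})`: it integrates `k` to
`k^n(x) / n`. -/
def empiricalMeasure {d : ℕ} (n : ℕ) (x : FullShift d) : Measure (FullShift d) :=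
  (n : ENNReal)⁻¹ • ∑ i ∈ Finset.range n, Measure.dirac (shift^[i] x)

/-- The denominator `∑_{n ≥ 1} ∑_{x ∈ Fix_n} exp (c s f^n(x) - n P(c f))`. -/
def zetaNormalization {d : ℕ} (f : FullShift d → ℝ) (c s : ℝ) : ENNReal :=
  ∑' n : ℕ, ∑' x : Fix d (n + 1), ENNReal.ofReal (weight f c s (n + 1) x)

/-- The measure `μ_{c,s}`: it integrates a continuous `k` to the quotient of
`∑_{n ≥ 1} ∑_{x ∈ Fix_n} exp (c s f^n(x) - n P(c f)) k^n(x) / n` by the normalization. -/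
def zetaMeasure {d : ℕ} (f : FullShift d → ℝ) (c s : ℝ) : Measure (FullShift d) :=
  (zetaNormalization f c s)⁻¹ • Measure.sum fun n : ℕ => Measure.sum fun x : Fix d (n + 1) =>
    ENNReal.ofReal (weight f c s (n + 1) x) • empiricalMeasure (n + 1) (x : FullShift d)

/-- `I(x) = n_x β(f) - f^{n_x}(x)` for periodic `x`, with `n_x` the minimal period. -/
def rate {d : ℕ} (f : FullShift d → ℝ) (x : FullShift d) : ℝ :=
  Function.minimalPeriod shift x * maxAverage f
    - birkhoffSum shift f (Function.minimalPeriod shift x) x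

/-- The infimum of `I` over the periodic points in a set `k`. -/
def infRate {d : ℕ} (f : FullShift d → ℝ) (k : Set (FullShift d)) : ℝ :=
  sInf (rate f '' (k ∩ Function.periodicPts shift))

end ZetaLDP

end

/-!
Write `f^n` for the Birkhoff sums, `β = maxAverage f` and `A = c (1 - s)`. On `Fix_n` the weight is
`exp (c f^n - A f^n - n P(cf))`, where `n β - f^n ≥ 0` is a positive multiple of the cost `I` of the
orbit, and where `A` is eventually bounded below by a positive constant because `L > 0`. Both the
mass of the cylinder and the normalization are values of the unnormalized measure `zetaSum`, and
`tendsto_log_zetaSum` shows that `(1/c) log` of its value at `k` tends to `-infRate f k`.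

* *Lower bound* (`le_zetaSum`): keep a single periodic orbit through `k` that is nearly optimal; the
  corrections `A f^p` and `p (P(cf) - c β)` are `o(c)` for fixed `p`.
* *Upper bound* (`zetaSum_le`): the difficulty is the number of orbits, which grows exponentially
  in `n`. An orbit meeting `k` satisfies `n β - f^n ≥ infRate f k`. Use this for the proportion
  `1 - η` of `c f^n`; it yields the factor `exp (-(1 - η) c infRate f k)`. What is left is the sum of
  `exp (η c f^n)` over `Fix_n`, at most `exp (n P(η c f) + η c K)` by supermultiplicativity of the
  partition functions and bounded distortion (`partitionFunction_le`). The growth rate in `n` is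
  then the difference at `η c` and `c` of the excess pressure `P(cf) - c β`. This excess is
  nonincreasing and nonnegative, so that the difference tends to `0`
  (`tendsto_excessPressure_sub`) and is beaten by the damping `exp (-n A min f)`. The sum over `n`
  is thus bounded by a geometric series independent of `c`. Finally `η → 0`.
* *Normalization* (`infRate_univ`): the infimum of `I` over all periodic orbits vanishes. Otherwise
  cutting a long closed orbit at repetitions of a long word would make the cost grow linearly in
  the period (`exists_linear_cost`), and the Birkhoff averages would stay away from `β`.
-/

namespace ZetaLDP

variable {d : ℕ}

/-! ### Periodic points and bounded distortion -/

theorem shift_iterate_apply (n i : ℕ) (x : FullShift d) : shift^[n] x i = x (i + n) := by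
  induction n generalizing x with
  | zero => rfl
  | succ n ih => rw [Function.iterate_succ_apply, ih]; simp [shift, add_assoc]

theorem mem_Fix_iff {n : ℕ} {x : FullShift d} : x ∈ Fix d n ↔ ∀ i, x (i + n) = x i := by
  simp only [Fix, Set.mem_ofPred_eq, Function.IsPeriodicPt, Function.IsFixedPt, funext_iff,
    shift_iterate_apply]

/-- The point `(x₀ x₁ … x_{p-1})^∞` of `Fix_p` (equal to `x` when `p = 0`). -/
def periodize (p : ℕ) (x : FullShift d) : FullShift d := fun i => x (i % p)

theorem periodize_mem_Fix (p : ℕ) (x : FullShift d) : periodize p x ∈ Fix d p :=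
  mem_Fix_iff.2 fun i => by simp [periodize]

theorem periodize_apply_of_lt_add {p m : ℕ} {x : FullShift d} (h : ∀ i < m, x (i + p) = x i)
    {i : ℕ} (hi : i < p + m) : periodize p x i = x i := by
  induction i using Nat.strong_induction_on with
  | _ i ih =>
    rcases lt_or_ge i p with hip | hip
    · simp [periodize, Nat.mod_eq_of_lt hip]
    · rcases Nat.eq_zero_or_pos p with rfl | hp
      · simp [periodize]
      · obtain ⟨j, rfl⟩ := Nat.exists_eq_add_of_le' hip
        rw [h j (by omega), ← ih j (by omega) (by omega)]
        simp [periodize]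

theorem shift_iterate_mem_Fix {n : ℕ} {x : FullShift d} (hx : x ∈ Fix d n) (i : ℕ) :
    shift^[i] x ∈ Fix d n :=
  mem_Fix_iff.2 fun j => by
    rw [shift_iterate_apply, shift_iterate_apply, ← mem_Fix_iff.1 hx (j + i)]
    congr 1; omega

theorem birkhoffSum_shift_iterate {n : ℕ} {x : FullShift d} (hx : x ∈ Fix d n)
    (f : FullShift d → ℝ) (i : ℕ) :
    birkhoffSum shift f n (shift^[i] x) = birkhoffSum shift f n x := by
  induction i with
  | zero => rfl
  | succ i ih =>
    rw [Function.iterate_succ_apply', ← ih, ← sub_eq_zero, birkhoffSum_apply_sub_birkhoffSum,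
      show shift^[n] (shift^[i] x) = shift^[i] x from shift_iterate_mem_Fix hx i, sub_self]

theorem birkhoffSum_mul_of_mem_Fix {n : ℕ} {x : FullShift d} (hx : x ∈ Fix d n)
    (f : FullShift d → ℝ) (q : ℕ) :
    birkhoffSum shift f (n * q) x = q * birkhoffSum shift f n x := by
  induction q with
  | zero => simp
  | succ q ih =>
    have h : shift^[n * q] x = x := Function.IsPeriodicPt.mul_const hx q
    rw [Nat.mul_succ, birkhoffSum_add, ih, h]
    push_cast; ring

/-- Two points that share their first `n + m` symbols have `n`-th Birkhoff sums that are
`K θ ^ m`-close, uniformly in `n`. -/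
def BoundedDistortion (θ K : ℝ) (f : FullShift d → ℝ) : Prop :=
  ∀ n m x y, (∀ i < n + m, x i = y i) →
    |birkhoffSum shift f n x - birkhoffSum shift f n y| ≤ K * θ ^ m

theorem dTheta_le {θ : ℝ} (hθ0 : 0 < θ) (hθ1 : θ < 1) {N : ℕ} {x y : FullShift d}
    (h : ∀ i < N, x i = y i) : dTheta θ x y ≤ θ ^ N := by
  unfold dTheta
  split_ifs with hxy
  · positivity
  · refine pow_le_pow_of_le_one hθ0.le hθ1.le ?_
    by_contra! hlt
    exact PiNat.apply_firstDiff_ne hxy (h _ (by omega))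

theorem IsLipschitz.exists_abs_sub_le {θ : ℝ} (hθ0 : 0 < θ) (hθ1 : θ < 1) {f : FullShift d → ℝ}
    (hf : IsLipschitz θ f) :
    ∃ C, 0 ≤ C ∧ ∀ N x y, (∀ i < N, x i = y i) → |f x - f y| ≤ C * θ ^ N := by
  obtain ⟨C, hC⟩ := hf
  refine ⟨max C 0, le_max_right _ _, fun N x y h => (hC x y).trans ?_⟩
  have h0 : 0 ≤ dTheta θ x y := by unfold dTheta; split_ifs <;> positivity
  exact mul_le_mul (le_max_left _ _) (dTheta_le hθ0 hθ1 h) h0 (le_max_right _ _)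

theorem IsLipschitz.continuous {θ : ℝ} (hθ0 : 0 < θ) (hθ1 : θ < 1) {f : FullShift d → ℝ}
    (hf : IsLipschitz θ f) : Continuous f := by
  obtain ⟨C, hC0, hC⟩ := hf.exists_abs_sub_le hθ0 hθ1
  rw [continuous_iff_continuousAt]
  intro x
  rw [ContinuousAt, Metric.tendsto_nhds]
  intro ε hε
  have hlim : Tendsto (fun N : ℕ => C * θ ^ N) atTop (𝓝 (C * 0)) :=
    (tendsto_pow_atTop_nhds_zero_of_lt_one hθ0.le hθ1).const_mul C
  rw [mul_zero] at hlim
  obtain ⟨N, hN⟩ := (hlim.eventually (gt_mem_nhds hε)).exists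
  filter_upwards [(PiNat.isOpen_cylinder _ x N).mem_nhds (PiNat.self_mem_cylinder x N)] with y hy
  rw [Real.dist_eq]
  exact (hC N y x fun i hi => PiNat.mem_cylinder_iff.1 hy i hi).trans_lt hN

theorem IsLipschitz.exists_boundedDistortion {θ : ℝ} (hθ0 : 0 < θ) (hθ1 : θ < 1)
    {f : FullShift d → ℝ} (hf : IsLipschitz θ f) : ∃ K, 0 ≤ K ∧ BoundedDistortion θ K f := by
  obtain ⟨C, hC0, hC⟩ := hf.exists_abs_sub_le hθ0 hθ1
  have h1 : 0 < 1 - θ := by linarith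
  refine ⟨C / (1 - θ), by positivity, fun n m x y h => ?_⟩
  suffices H : |birkhoffSum shift f n x - birkhoffSum shift f n y|
      ≤ C / (1 - θ) * θ ^ m * (1 - θ ^ n) by
    refine H.trans (mul_le_of_le_one_right (by positivity) ?_)
    linarith [pow_pos hθ0 n]
  induction n generalizing x y with
  | zero => simp
  | succ n ih =>
    rw [birkhoffSum_succ', birkhoffSum_succ']
    have e1 := hC (n + m) x y fun i hi => h i (by omega)
    have e2 := ih (shift x) (shift y) fun i hi => h (i + 1) (by omega)
    have e3 : C / (1 - θ) * θ ^ m * (1 - θ ^ (n + 1))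
        = C * θ ^ (n + m) + C / (1 - θ) * θ ^ m * (1 - θ ^ n) := by
      field_simp; ring
    rw [e3, add_sub_add_comm]
    exact (abs_add_le _ _).trans (add_le_add e1 e2)

theorem BoundedDistortion.le_add {θ K : ℝ} {f : FullShift d → ℝ} (h : BoundedDistortion θ K f)
    {n : ℕ} {x y : FullShift d} (hxy : ∀ i < n, x i = y i) :
    birkhoffSum shift f n x ≤ birkhoffSum shift f n y + K := by
  have := (abs_le.1 (h n 0 x y (by simpa using hxy))).2
  simp only [pow_zero, mul_one] at this
  linarith

theorem birkhoffSum_const_mul (f : FullShift d → ℝ) (c : ℝ) (n : ℕ) (x : FullShift d) :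
    birkhoffSum shift (fun y => c * f y) n x = c * birkhoffSum shift f n x := by
  simp [birkhoffSum, Finset.mul_sum]

theorem BoundedDistortion.const_mul {θ K : ℝ} {f : FullShift d → ℝ} (h : BoundedDistortion θ K f)
    {c : ℝ} (hc : 0 ≤ c) : BoundedDistortion θ (c * K) fun y => c * f y := by
  intro n m x y hxy
  rw [birkhoffSum_const_mul, birkhoffSum_const_mul, ← mul_sub, abs_mul, abs_of_nonneg hc, mul_assoc]
  exact mul_le_mul_of_nonneg_left (h n m x y hxy) hc

theorem birkhoffSum_le {f : FullShift d → ℝ} {M : ℝ} (h : ∀ x, f x ≤ M) (n : ℕ)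
    (x : FullShift d) : birkhoffSum shift f n x ≤ n * M := by
  simpa [birkhoffSum] using Finset.sum_le_card_nsmul (Finset.range n) _ M fun i _ => h (shift^[i] x)

theorem le_birkhoffSum {f : FullShift d → ℝ} {M : ℝ} (h : ∀ x, M ≤ f x) (n : ℕ)
    (x : FullShift d) : n * M ≤ birkhoffSum shift f n x := by
  simpa [birkhoffSum] using Finset.card_nsmul_le_sum (Finset.range n) _ M fun i _ => h (shift^[i] x)

/-! ### Partition functions and pressure -/

theorem cylinderWord_nonempty [NeZero d] {n : ℕ} (w : Fin n → Fin d) :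
    {x : FullShift d | ∀ i : Fin n, x i = w i}.Nonempty :=
  ⟨fun i => if h : i < n then w ⟨i, h⟩ else 0, fun i => by simp⟩

theorem exp_le_sSup {θ C : ℝ} {g : FullShift d → ℝ} (hg : BoundedDistortion θ C g) {n : ℕ}
    {w : Fin n → Fin d} {x : FullShift d} (hx : ∀ i : Fin n, x i = w i) :
    Real.exp (birkhoffSum shift g n x) ≤ sSup ((fun x => Real.exp (birkhoffSum shift g n x)) ''
      {x : FullShift d | ∀ i : Fin n, x i = w i}) := by
  refine le_csSup ⟨Real.exp (birkhoffSum shift g n x + C), ?_⟩ ⟨x, hx, rfl⟩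
  rintro _ ⟨y, hy, rfl⟩
  exact Real.exp_le_exp.2 (hg.le_add fun i hi => (hy ⟨i, hi⟩).trans (hx ⟨i, hi⟩).symm)

theorem exp_le_partitionFunction {θ C : ℝ} {g : FullShift d → ℝ} (hg : BoundedDistortion θ C g)
    (n : ℕ) (x : FullShift d) :
    Real.exp (birkhoffSum shift g n x) ≤ partitionFunction g n := by
  refine (exp_le_sSup hg (w := fun i => x i) fun i => rfl).trans ?_
  refine Finset.single_le_sum (f := fun w : Fin n → Fin d =>
    sSup ((fun x => Real.exp (birkhoffSum shift g n x)) ''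
      {x : FullShift d | ∀ i : Fin n, x i = w i})) (fun w _ => ?_) (Finset.mem_univ _)
  refine Real.sSup_nonneg ?_
  rintro _ ⟨y, -, rfl⟩
  positivity

theorem partitionFunction_pos [NeZero d] {θ C : ℝ} {g : FullShift d → ℝ}
    (hg : BoundedDistortion θ C g) (n : ℕ) : 0 < partitionFunction g n :=
  (Real.exp_pos _).trans_le (exp_le_partitionFunction hg n fun _ => 0)

/-- Supermultiplicativity of the partition functions, up to the distortion constant. -/
theorem partitionFunction_mul_le [NeZero d] {θ C : ℝ} {g : FullShift d → ℝ}
    (hg : BoundedDistortion θ C g) (n p : ℕ) :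
    partitionFunction g n * partitionFunction g p ≤ Real.exp C * partitionFunction g (n + p) := by
  have hsplit : partitionFunction g (n + p) = ∑ w : (Fin n → Fin d) × (Fin p → Fin d),
      sSup ((fun x => Real.exp (birkhoffSum shift g (n + p) x)) ''
        {x : FullShift d | ∀ i : Fin (n + p), x i = Fin.append w.1 w.2 i}) :=
    (Fintype.sum_equiv (Fin.appendEquiv n p) _ _ fun w => rfl).symm
  rw [hsplit, partitionFunction, partitionFunction, Finset.sum_mul_sum, ← Finset.sum_product',
    Finset.univ_product_univ, Finset.mul_sum]
  refine Finset.sum_le_sum fun w _ => ?_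
  set T := sSup ((fun x => Real.exp (birkhoffSum shift g (n + p) x)) ''
        {x : FullShift d | ∀ i : Fin (n + p), x i = Fin.append w.1 w.2 i}) with hT
  have key : ∀ x : FullShift d, (∀ i : Fin n, x i = w.1 i) → ∀ y : FullShift d,
      (∀ i : Fin p, y i = w.2 i) →
      Real.exp (birkhoffSum shift g n x) * Real.exp (birkhoffSum shift g p y)
        ≤ Real.exp C * T := by
    intro x hx y hy
    -- the first word followed by the point `y` of the second cylinder
    let z : FullShift d := fun i => if i < n then x i else y (i - n)
    have hz : ∀ i : Fin (n + p), z i = Fin.append w.1 w.2 i := by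
      intro i
      refine Fin.addCases (fun j => ?_) (fun j => ?_) i
      · simp [z, hx]
      · simp [z, hy]
    have hzy : shift^[n] z = y := by
      funext i; simp [shift_iterate_apply, z]
    have h1 := hg.le_add (n := n) (x := x) (y := z) fun i hi => by simp [z, hi]
    have h2 := exp_le_sSup hg hz
    rw [← hT, birkhoffSum_add, hzy] at h2
    refine le_trans ?_ (mul_le_mul_of_nonneg_left h2 (Real.exp_pos C).le)
    rw [← Real.exp_add, ← Real.exp_add]
    exact Real.exp_le_exp.2 (by linarith)
  obtain ⟨y₀, hy₀⟩ := cylinderWord_nonempty w.2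
  have hstep : ∀ x : FullShift d, (∀ i : Fin n, x i = w.1 i) →
      Real.exp (birkhoffSum shift g n x) * sSup ((fun x => Real.exp (birkhoffSum shift g p x)) ''
        {x : FullShift d | ∀ i : Fin p, x i = w.2 i}) ≤ Real.exp C * T := by
    intro x hx
    rw [mul_comm, ← le_div_iff₀ (Real.exp_pos _)]
    refine csSup_le ⟨_, y₀, hy₀, rfl⟩ ?_
    rintro _ ⟨y, hy, rfl⟩
    rw [le_div_iff₀ (Real.exp_pos _), mul_comm]
    exact key x hx y hy
  have hS : 0 < sSup ((fun x => Real.exp (birkhoffSum shift g p x)) ''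
        {x : FullShift d | ∀ i : Fin p, x i = w.2 i}) :=
    (Real.exp_pos _).trans_le (exp_le_sSup hg hy₀)
  rw [← le_div_iff₀ hS]
  refine csSup_le ((cylinderWord_nonempty w.1).image _) ?_
  rintro _ ⟨x, hx, rfl⟩
  rw [le_div_iff₀ hS]
  exact hstep x hx

theorem log_partitionFunction_le [NeZero d] {θ C M : ℝ} {g : FullShift d → ℝ}
    (hg : BoundedDistortion θ C g) (hM : ∀ x, g x ≤ M) (n : ℕ) :
    Real.log (partitionFunction g n) ≤ n * (Real.log d + M) := by
  have hd : (0 : ℝ) < d := by exact_mod_cast Nat.pos_of_ne_zero (NeZero.ne d)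
  have h : partitionFunction g n ≤ (d : ℝ) ^ n * Real.exp (n * M) := by
    have : ∀ w ∈ (Finset.univ : Finset (Fin n → Fin d)),
        sSup ((fun x => Real.exp (birkhoffSum shift g n x)) ''
          {x : FullShift d | ∀ i : Fin n, x i = w i}) ≤ Real.exp (n * M) := by
      intro w _
      refine csSup_le ((cylinderWord_nonempty w).image _) ?_
      rintro _ ⟨x, -, rfl⟩
      exact Real.exp_le_exp.2 (birkhoffSum_le hM n x)
    simpa [partitionFunction] using Finset.sum_le_card_nsmul _ _ _ this
  refine (Real.log_le_log (partitionFunction_pos hg n) h).trans_eq ?_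
  rw [Real.log_mul (by positivity) (Real.exp_pos _).ne', Real.log_pow, Real.log_exp]
  ring

theorem subadditive_sub_log_partitionFunction [NeZero d] {θ C : ℝ} {g : FullShift d → ℝ}
    (hg : BoundedDistortion θ C g) :
    Subadditive fun n => C - Real.log (partitionFunction g n) := by
  intro n p
  have h := Real.log_le_log (mul_pos (partitionFunction_pos hg n) (partitionFunction_pos hg p))
    (partitionFunction_mul_le hg n p)
  rw [Real.log_mul (partitionFunction_pos hg n).ne' (partitionFunction_pos hg p).ne',
    Real.log_mul (Real.exp_pos C).ne' (partitionFunction_pos hg _).ne', Real.log_exp] at h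
  dsimp only
  linarith

theorem bddBelow_sub_log_partitionFunction_div [NeZero d] {θ C M : ℝ} {g : FullShift d → ℝ}
    (hg : BoundedDistortion θ C g) (hM : ∀ x, g x ≤ M) (hM0 : 0 ≤ M) :
    BddBelow (Set.range fun n : ℕ => (C - Real.log (partitionFunction g n)) / n) := by
  have hC : 0 ≤ C := by simpa using hg.le_add (n := 0) (x := fun _ => 0) (y := fun _ => 0)
  have hd : 0 ≤ Real.log d := Real.log_natCast_nonneg d
  refine ⟨-(Real.log d + M), ?_⟩
  rintro _ ⟨n, rfl⟩
  rcases Nat.eq_zero_or_pos n with rfl | hn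
  · simp only [Nat.cast_zero, div_zero]; linarith
  · have hn' : (0 : ℝ) < n := by exact_mod_cast hn
    dsimp only
    rw [le_div_iff₀ hn']
    linarith [log_partitionFunction_le hg hM n]

theorem tendsto_log_partitionFunction [NeZero d] {θ C M : ℝ} {g : FullShift d → ℝ}
    (hg : BoundedDistortion θ C g) (hM : ∀ x, g x ≤ M) (hM0 : 0 ≤ M) :
    Tendsto (fun n : ℕ => 1 / (n : ℝ) * Real.log (partitionFunction g n)) atTop
      (𝓝 (-(subadditive_sub_log_partitionFunction hg).lim)) := by
  have h1 := (subadditive_sub_log_partitionFunction hg).tendsto_lim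
    (bddBelow_sub_log_partitionFunction_div hg hM hM0)
  have h2 : Tendsto (fun n : ℕ => C / (n : ℝ)) atTop (𝓝 0) := tendsto_const_div_atTop_nhds_zero_nat C
  have h3 := h2.sub h1
  rw [zero_sub] at h3
  refine h3.congr fun n => ?_
  ring

theorem pressure_eq [NeZero d] {θ C M : ℝ} {g : FullShift d → ℝ}
    (hg : BoundedDistortion θ C g) (hM : ∀ x, g x ≤ M) (hM0 : 0 ≤ M) :
    pressure g = -(subadditive_sub_log_partitionFunction hg).lim :=
  (tendsto_log_partitionFunction hg hM hM0).limsup_eq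

theorem tendsto_pressure [NeZero d] {θ C M : ℝ} {g : FullShift d → ℝ}
    (hg : BoundedDistortion θ C g) (hM : ∀ x, g x ≤ M) (hM0 : 0 ≤ M) :
    Tendsto (fun n : ℕ => 1 / (n : ℝ) * Real.log (partitionFunction g n)) atTop
      (𝓝 (pressure g)) :=
  pressure_eq hg hM hM0 ▸ tendsto_log_partitionFunction hg hM hM0

/-- The partition functions exceed `exp (n P(g))` at most by the distortion factor, whatever `n`. -/
theorem partitionFunction_le [NeZero d] {θ C M : ℝ} {g : FullShift d → ℝ}
    (hg : BoundedDistortion θ C g) (hM : ∀ x, g x ≤ M) (hM0 : 0 ≤ M) {n : ℕ} (hn : n ≠ 0) :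
    partitionFunction g n ≤ Real.exp (n * pressure g + C) := by
  have h := (subadditive_sub_log_partitionFunction hg).lim_le_div
    (bddBelow_sub_log_partitionFunction_div hg hM hM0) hn
  rw [← neg_neg (Subadditive.lim _), ← pressure_eq hg hM hM0,
    le_div_iff₀ (by exact_mod_cast Nat.pos_of_ne_zero hn)] at h
  rw [← Real.log_le_iff_le_exp (partitionFunction_pos hg n)]
  linarith

/-! ### Maximal ergodic averages and periodic orbits -/

theorem measurable_shift : Measurable (shift : FullShift d → FullShift d) :=
  measurable_pi_lambda _ fun n => measurable_pi_apply (n + 1)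

theorem empiricalMeasure_isProbabilityMeasure {n : ℕ} (hn : n ≠ 0) (x : FullShift d) :
    IsProbabilityMeasure (empiricalMeasure n x) := by
  refine ⟨?_⟩
  simp [empiricalMeasure, Measure.finsetSum_apply,
    ENNReal.inv_mul_cancel (Nat.cast_ne_zero.2 hn) (ENNReal.natCast_ne_top n)]

theorem empiricalMeasure_mem_invariantProbabilities {n : ℕ} (hn : n ≠ 0) {x : FullShift d}
    (hx : x ∈ Fix d n) : empiricalMeasure n x ∈ invariantProbabilities d := by
  refine ⟨empiricalMeasure_isProbabilityMeasure hn x, measurable_shift, ?_⟩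
  have h : ∑ i ∈ Finset.range n, Measure.dirac (shift^[i + 1] x)
      = ∑ i ∈ Finset.range n, Measure.dirac (shift^[i] x) := by
    have h1 := Finset.sum_range_succ' (fun i => Measure.dirac (shift^[i] x)) n
    have h2 := Finset.sum_range_succ (fun i => Measure.dirac (shift^[i] x)) n
    rw [show shift^[n] x = x from hx, h1] at h2
    ext s hs
    have h3 := congrArg (fun μ : Measure (FullShift d) => μ s) h2
    simp only [Function.iterate_zero, id_eq, Measure.add_apply] at h3
    exact (ENNReal.add_left_inj (measure_ne_top _ s)).1 h3
  rw [empiricalMeasure, Measure.map_smul, Measure.map_finset_sum measurable_shift.aemeasurable]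
  congr 1
  rw [← h]
  refine Finset.sum_congr rfl fun i _ => ?_
  rw [Measure.map_dirac' measurable_shift, ← Function.iterate_succ_apply' shift i x]

theorem integral_empiricalMeasure (n : ℕ) (x : FullShift d) (f : FullShift d → ℝ) :
    ∫ y, f y ∂empiricalMeasure n x = (n : ℝ)⁻¹ * birkhoffSum shift f n x := by
  rw [empiricalMeasure, integral_smul_measure, integral_finsetSum_measure]
  · simp [birkhoffSum, integral_dirac]
  · intro i _
    exact integrable_dirac (by simp)

theorem bddAbove_integral {f : FullShift d → ℝ} {M : ℝ} (hM : ∀ x, |f x| ≤ M) :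
    BddAbove ((fun ν : Measure (FullShift d) => ∫ x, f x ∂ν) '' invariantProbabilities d) := by
  refine ⟨M, ?_⟩
  rintro _ ⟨ν, ⟨hν, -⟩, rfl⟩
  have := norm_integral_le_of_norm_le_const (μ := ν) (f := f) (C := M) (Eventually.of_forall hM)
  simp only [probReal_univ, mul_one] at this
  exact (le_abs_self _).trans this

theorem birkhoffSum_le_maxAverage {f : FullShift d → ℝ} {M : ℝ}
    (hM : ∀ x, |f x| ≤ M) {n : ℕ} {x : FullShift d} (hx : x ∈ Fix d n) :
    birkhoffSum shift f n x ≤ n * maxAverage f := by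
  rcases Nat.eq_zero_or_pos n with rfl | hn
  · simp
  have h := le_csSup (bddAbove_integral hM)
    ⟨_, empiricalMeasure_mem_invariantProbabilities hn.ne' hx, rfl⟩
  dsimp only at h
  rw [integral_empiricalMeasure n x f, inv_mul_le_iff₀ (by exact_mod_cast hn)] at h
  exact h

theorem invariantProbabilities_nonempty [NeZero d] : (invariantProbabilities d).Nonempty :=
  ⟨_, empiricalMeasure_mem_invariantProbabilities one_ne_zero
    (periodize_mem_Fix 1 fun _ => 0)⟩

theorem integral_birkhoffSum {f : FullShift d → ℝ} (hf : Continuous f) {M : ℝ}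
    (hM : ∀ x, |f x| ≤ M) {ν : Measure (FullShift d)} (hν : ν ∈ invariantProbabilities d) (n : ℕ) :
    ∫ x, birkhoffSum shift f n x ∂ν = n * ∫ x, f x ∂ν := by
  obtain ⟨hν1, hν2⟩ := hν
  have hfi : Integrable f ν := Integrable.of_bound hf.aestronglyMeasurable M
    (Eventually.of_forall hM)
  simp only [birkhoffSum]
  rw [integral_finsetSum]
  · have : ∀ i, ∫ x, f (shift^[i] x) ∂ν = ∫ x, f x ∂ν := fun i => by
      have hmp := hν2.iterate i
      exact (integral_map hmp.aemeasurable hf.aestronglyMeasurable).symm.trans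
        (by rw [hmp.map_eq])
    simp [this]
  · intro i _
    exact (hν2.iterate i).integrable_comp_of_integrable hfi

theorem mul_maxAverage_le [NeZero d] {f : FullShift d → ℝ} (hf : Continuous f) {M : ℝ}
    (hM : ∀ x, |f x| ≤ M) {n : ℕ} {B : ℝ} (hB : ∀ x, birkhoffSum shift f n x ≤ B) :
    n * maxAverage f ≤ B := by
  rcases Nat.eq_zero_or_pos n with rfl | hn
  · simpa using hB fun _ => 0
  have hn' : (0 : ℝ) < n := by exact_mod_cast hn
  rw [mul_comm, ← le_div_iff₀ hn']
  refine csSup_le (invariantProbabilities_nonempty.image _) ?_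
  rintro _ ⟨ν, hν, rfl⟩
  have h := integral_birkhoffSum hf hM hν n
  obtain ⟨hν1, hν2⟩ := hν
  dsimp only
  rw [le_div_iff₀ hn', mul_comm, ← h]
  have hfi : Integrable f ν := Integrable.of_bound hf.aestronglyMeasurable M
    (Eventually.of_forall hM)
  have hint : Integrable (birkhoffSum shift f n) ν := by
    unfold birkhoffSum
    exact integrable_finsetSum _ fun i _ => (hν2.iterate i).integrable_comp_of_integrable hfi
  simpa using integral_mono hint (integrable_const B) hB

/-- Closing up an orbit segment of length `n` into a periodic orbit costs at most the distortion
constant, so the bound by `n β(f)` on `Fix_n` extends to all points. -/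
theorem birkhoffSum_le_maxAverage_add {f : FullShift d → ℝ} {M : ℝ}
    (hM : ∀ x, |f x| ≤ M) {θ K : ℝ} (hK : BoundedDistortion θ K f) (n : ℕ) (x : FullShift d) :
    birkhoffSum shift f n x ≤ n * maxAverage f + K :=
  (hK.le_add fun i hi => (periodize_apply_of_lt_add (m := 0) (by simp) hi).symm).trans
    (by gcongr; exact birkhoffSum_le_maxAverage hM (periodize_mem_Fix n x))

/-! ### The rate of periodic orbits -/

theorem rate_nonneg {f : FullShift d → ℝ} {M : ℝ}
    (hM : ∀ x, |f x| ≤ M) (x : FullShift d) : 0 ≤ rate f x :=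
  sub_nonneg.2 (birkhoffSum_le_maxAverage hM (Function.isPeriodicPt_minimalPeriod shift x))

theorem bddBelow_rate {f : FullShift d → ℝ} {M : ℝ}
    (hM : ∀ x, |f x| ≤ M) (k : Set (FullShift d)) :
    BddBelow (rate f '' (k ∩ Function.periodicPts shift)) :=
  ⟨0, by rintro _ ⟨x, -, rfl⟩; exact rate_nonneg hM x⟩

theorem infRate_nonneg {f : FullShift d → ℝ} {M : ℝ}
    (hM : ∀ x, |f x| ≤ M) (k : Set (FullShift d)) : 0 ≤ infRate f k :=
  Real.sInf_nonneg (by rintro _ ⟨x, -, rfl⟩; exact rate_nonneg hM x)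

/-- A point of `Fix_n` runs `n / n_x ≥ 1` times through its orbit, each time at the cost `I(x)`. -/
theorem infRate_le {f : FullShift d → ℝ} {M : ℝ}
    (hM : ∀ x, |f x| ≤ M) {k : Set (FullShift d)} {n : ℕ} (hn : n ≠ 0) {x : FullShift d}
    (hx : x ∈ Fix d n) (hxk : x ∈ k) :
    infRate f k ≤ n * maxAverage f - birkhoffSum shift f n x := by
  have hper : x ∈ Function.periodicPts shift := ⟨n, Nat.pos_of_ne_zero hn, hx⟩
  refine (csInf_le (bddBelow_rate hM k) ⟨x, ⟨hxk, hper⟩, rfl⟩).trans ?_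
  obtain ⟨q, hq⟩ := Function.IsPeriodicPt.minimalPeriod_dvd hx
  have hq1 : (1 : ℝ) ≤ q := by
    rcases Nat.eq_zero_or_pos q with rfl | h
    · simp at hq; omega
    · exact_mod_cast h
  have h1 : birkhoffSum shift f n x
      = q * birkhoffSum shift f (Function.minimalPeriod shift x) x := by
    rw [hq]
    exact birkhoffSum_mul_of_mem_Fix (Function.isPeriodicPt_minimalPeriod shift x) f q
  have h2 : (n : ℝ) = Function.minimalPeriod shift x * q := by exact_mod_cast hq
  have h3 := rate_nonneg hM x
  have h4 : n * maxAverage f - birkhoffSum shift f n x = q * rate f x := by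
    rw [h1, h2, rate]; ring
  rw [h4]
  exact le_mul_of_one_le_left h3 hq1

theorem exists_repeated_word (m : ℕ) (x : FullShift d) :
    ∃ i j, i < j ∧ j ≤ d ^ m ∧ ∀ l < m, x (j + l) = x (i + l) := by
  let F : Fin (d ^ m + 1) → (Fin m → Fin d) := fun i l => x (i + l)
  obtain ⟨i, j, hij, hF⟩ := Fintype.exists_ne_map_eq_of_card_lt F (by simp)
  have hF' : ∀ l < m, x (i + l) = x (j + l) := fun l hl => congrFun hF ⟨l, hl⟩
  rcases lt_or_gt_of_ne (fun h => hij (Fin.ext h) : (i : ℕ) ≠ j) with h | h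
  · exact ⟨i, j, h, by omega, fun l hl => (hF' l hl).symm⟩
  · exact ⟨j, i, h, by omega, hF'⟩

/-- A closed orbit of length `n` with the same word of length `m` at the times `0` and `j` splits
into two closed orbits, of lengths `j` and `n - j`, at a cost exponentially small in `m`. -/
theorem exists_split {θ K : ℝ} {f : FullShift d → ℝ} (hK : BoundedDistortion θ K f) {j p m : ℕ}
    {x : FullShift d} (hx : x ∈ Fix d (j + p)) (hj : ∀ l < m, x (j + l) = x l) :
    ∃ y ∈ Fix d j, ∃ z ∈ Fix d p, birkhoffSum shift f (j + p) x
      ≤ birkhoffSum shift f j y + birkhoffSum shift f p z + 2 * (K * θ ^ m) := by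
  refine ⟨_, periodize_mem_Fix j x, _, periodize_mem_Fix p (shift^[j] x), ?_⟩
  have h1 := hK j m x (periodize j x) fun i hi =>
    (periodize_apply_of_lt_add (fun l hl => by rw [add_comm, hj l hl]) hi).symm
  have h2 := hK p m (shift^[j] x) (periodize p (shift^[j] x)) fun i hi =>
    (periodize_apply_of_lt_add (fun l hl => by
      rw [shift_iterate_apply, shift_iterate_apply, add_comm l j, hj l hl,
        ← mem_Fix_iff.1 hx l]
      congr 1; omega) hi).symm
  rw [birkhoffSum_add]
  linarith [(abs_le.1 h1).2, (abs_le.1 h2).2]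

/-- If all periodic orbits cost at least `I₀ > 0`, then the cost grows linearly in the period:
a long closed orbit can be cut successively into closed orbits of bounded length. -/
theorem exists_linear_cost {θ K : ℝ} (hθ0 : 0 < θ) (hθ1 : θ < 1) {f : FullShift d → ℝ}
    (hK : BoundedDistortion θ K f) {b I₀ : ℝ} (hI : 0 < I₀)
    (h : ∀ n ≠ 0, ∀ x ∈ Fix d n, I₀ ≤ n * b - birkhoffSum shift f n x) :
    ∃ κ > 0, ∀ n, ∀ x ∈ Fix d n, n * κ ≤ n * b - birkhoffSum shift f n x := by
  have hlim : Tendsto (fun m : ℕ => 2 * (K * θ ^ m)) atTop (𝓝 (2 * (K * 0))) :=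
    ((tendsto_pow_atTop_nhds_zero_of_lt_one hθ0.le hθ1).const_mul K).const_mul 2
  rw [mul_zero, mul_zero] at hlim
  obtain ⟨m, hm⟩ := (hlim.eventually (gt_mem_nhds (half_pos hI))).exists
  rcases Nat.eq_zero_or_pos (d ^ m) with hD | hD
  · refine ⟨1, one_pos, fun n x => ?_⟩
    rw [pow_eq_zero_iff'] at hD
    exact absurd (x 0).pos (by omega)
  have hD' : (0 : ℝ) < (d ^ m : ℕ) := by exact_mod_cast hD
  have hκ : ∀ j : ℕ, j ≤ d ^ m → (j : ℝ) * (I₀ / 2 / (d ^ m : ℕ)) ≤ I₀ / 2 := by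
    intro j hj
    rw [mul_div_assoc', div_le_iff₀ hD', mul_comm]
    gcongr
  refine ⟨I₀ / 2 / (d ^ m : ℕ), by positivity, fun n => ?_⟩
  induction n using Nat.strong_induction_on with
  | _ n ih =>
    intro x hx
    rcases Nat.eq_zero_or_pos n with rfl | hn
    · simp
    rcases le_or_gt n (d ^ m) with hnD | hnD
    · linarith [h n hn.ne' x hx, hκ n hnD]
    obtain ⟨i, k, hik, hkD, hrep⟩ := exists_repeated_word m x
    obtain ⟨j, rfl⟩ := Nat.exists_eq_add_of_lt hik
    -- start the orbit at the first occurrence of the repeated word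
    have hx' := shift_iterate_mem_Fix hx i
    rw [← birkhoffSum_shift_iterate hx f i]
    obtain ⟨p, rfl⟩ := Nat.exists_eq_add_of_le (show j + 1 ≤ n by omega)
    obtain ⟨y, hy, z, hz, hyz⟩ := exists_split hK (m := m) hx' fun l hl => by
      rw [shift_iterate_apply, shift_iterate_apply, add_comm l i, ← hrep l hl]
      congr 1; omega
    have h1 := h (j + 1) (by omega) y hy
    have h2 := ih p (by omega) z hz
    have h3 := hκ (j + 1) (by omega)
    push_cast at *
    linarith

theorem infRate_univ [NeZero d] {θ K : ℝ} (hθ0 : 0 < θ) (hθ1 : θ < 1) {f : FullShift d → ℝ}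
    (hf : Continuous f) {M : ℝ} (hM : ∀ x, |f x| ≤ M) (hK : BoundedDistortion θ K f) :
    infRate f Set.univ = 0 := by
  refine le_antisymm ?_ (infRate_nonneg hM _)
  by_contra! hpos
  obtain ⟨κ, hκ, hlin⟩ := exists_linear_cost hθ0 hθ1 hK hpos fun n hn x hx =>
    infRate_le hM hn hx (Set.mem_univ x)
  -- all Birkhoff sums, hence `n β(f)`, are then bounded by `n (β(f) - κ) + K`
  have hle : ∀ n : ℕ, (n : ℝ) * κ ≤ K := by
    intro n
    have := mul_maxAverage_le hf hM (n := n) (B := n * maxAverage f - n * κ + K) fun x => by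
      have h1 := hK.le_add (n := n) (x := x) (y := periodize n x) fun i hi =>
        (periodize_apply_of_lt_add (m := 0) (by simp) hi).symm
      linarith [hlin n _ (periodize_mem_Fix n x)]
    linarith
  obtain ⟨n, hn⟩ := exists_nat_gt (K / κ)
  rw [div_lt_iff₀ hκ] at hn
  exact absurd (hle n) (not_le.2 hn)

/-! ### The excess pressure -/

/-- The excess `P(cf) - c β(f)` of the pressure over its zero-temperature part. -/
noncomputable def excessPressure (f : FullShift d → ℝ) (c : ℝ) : ℝ :=
  pressure (fun y => c * f y) - c * maxAverage f

theorem excessPressure_nonneg [NeZero d] {θ K : ℝ} {f : FullShift d → ℝ}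
    (hf : Continuous f) {M : ℝ} (hM : ∀ x, |f x| ≤ M) (hK : BoundedDistortion θ K f)
    {c : ℝ} (hc : 0 < c) : 0 ≤ excessPressure f c := by
  have hM0 : 0 ≤ M := (abs_nonneg _).trans (hM fun _ => 0)
  have hg := hK.const_mul hc.le
  refine sub_nonneg.2 (ge_of_tendsto (tendsto_pressure hg (M := c * M)
    (fun x => mul_le_mul_of_nonneg_left ((le_abs_self _).trans (hM x)) hc.le) (by positivity)) ?_)
  filter_upwards [eventually_gt_atTop 0] with n hn
  have hn' : (0 : ℝ) < n := by exact_mod_cast hn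
  have h := mul_maxAverage_le hf hM (n := n)
    (B := Real.log (partitionFunction (fun y => c * f y) n) / c) fun x => by
      rw [le_div_iff₀ hc, mul_comm, ← birkhoffSum_const_mul,
        Real.le_log_iff_exp_le (partitionFunction_pos hg n)]
      exact exp_le_partitionFunction hg n x
  rw [le_div_iff₀ hc] at h
  rw [one_div, le_inv_mul_iff₀ hn']
  linarith

theorem excessPressure_anti [NeZero d] {θ K : ℝ} {f : FullShift d → ℝ} {M : ℝ}
    (hM : ∀ x, |f x| ≤ M) (hK : BoundedDistortion θ K f)
    {c c' : ℝ} (hc : 0 < c) (hcc' : c ≤ c') : excessPressure f c' ≤ excessPressure f c := by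
  have hM0 : 0 ≤ M := (abs_nonneg _).trans (hM fun _ => 0)
  have hc' := hc.trans_le hcc'
  have hB : ∀ {c : ℝ}, 0 < c → ∀ x, c * f x ≤ c * M := fun hc x =>
    mul_le_mul_of_nonneg_left ((le_abs_self _).trans (hM x)) hc.le
  have t := tendsto_pressure (hK.const_mul hc.le) (hB hc) (by positivity)
  have t' := tendsto_pressure (hK.const_mul hc'.le) (hB hc') (by positivity)
  have t0 : Tendsto (fun n : ℕ => (c' - c) * K / (n : ℝ)) atTop (𝓝 0) :=
    tendsto_const_div_atTop_nhds_zero_nat _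
  have key : pressure (fun y => c' * f y)
      ≤ pressure (fun y => c * f y) + (c' - c) * maxAverage f + 0 := by
    refine le_of_tendsto_of_tendsto t' ((t.add_const _).add t0) ?_
    filter_upwards [eventually_gt_atTop 0] with n hn
    have hn' : (0 : ℝ) < n := by exact_mod_cast hn
    have hZ : partitionFunction (fun y => c' * f y) n
        ≤ partitionFunction (fun y => c * f y) n
          * Real.exp ((c' - c) * (n * maxAverage f + K)) := by
      rw [partitionFunction, partitionFunction, Finset.sum_mul]
      refine Finset.sum_le_sum fun w _ => ?_
      refine csSup_le ((cylinderWord_nonempty w).image _) ?_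
      rintro _ ⟨x, hx, rfl⟩
      refine le_trans ?_ (mul_le_mul_of_nonneg_right (exp_le_sSup (hK.const_mul hc.le) hx)
        (Real.exp_pos _).le)
      simp only [← Real.exp_add, birkhoffSum_const_mul]
      refine Real.exp_le_exp.2 ?_
      have := mul_le_mul_of_nonneg_left (birkhoffSum_le_maxAverage_add hM hK n x)
        (sub_nonneg.2 hcc')
      linarith
    have hlog := Real.log_le_log (partitionFunction_pos (hK.const_mul hc'.le) n) hZ
    rw [Real.log_mul (partitionFunction_pos (hK.const_mul hc.le) n).ne' (Real.exp_pos _).ne',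
      Real.log_exp] at hlog
    rw [one_div, inv_mul_le_iff₀ hn']
    refine hlog.trans_eq ?_
    field_simp
    ring
  unfold excessPressure
  linarith

/-- The excess pressure is nonincreasing and nonnegative, hence convergent; so rescaling `c` by a
constant factor does not matter in the limit. -/
theorem tendsto_excessPressure_sub [NeZero d] {θ K : ℝ} {f : FullShift d → ℝ}
    (hf : Continuous f) {M : ℝ} (hM : ∀ x, |f x| ≤ M) (hK : BoundedDistortion θ K f)
    {η : ℝ} (hη : 0 < η) :
    Tendsto (fun c => excessPressure f (η * c) - excessPressure f c) atTop (𝓝 0) := by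
  have hanti : Antitone fun c => excessPressure f (max c 1) := fun c c' h =>
    excessPressure_anti hM hK (by positivity) (max_le_max_right 1 h)
  have hbdd : BddBelow (Set.range fun c => excessPressure f (max c 1)) :=
    ⟨0, by rintro _ ⟨c, rfl⟩; exact excessPressure_nonneg hf hM hK (by positivity)⟩
  have hlim := tendsto_atTop_ciInf hanti hbdd
  have hlim' := hlim.congr' (f₂ := excessPressure f) (by
    filter_upwards [eventually_ge_atTop 1] with c hc
    rw [max_eq_left hc])
  simpa using (hlim'.comp (tendsto_id.const_mul_atTop hη)).sub hlim'

/-! ### Exponential bounds for the zeta measures -/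

/-- The zeta measure before normalization. -/
noncomputable def zetaSum (f : FullShift d → ℝ) (c s : ℝ) : Measure (FullShift d) :=
  Measure.sum fun n : ℕ => Measure.sum fun x : Fix d (n + 1) =>
    ENNReal.ofReal (weight f c s (n + 1) x) • empiricalMeasure (n + 1) (x : FullShift d)

theorem zetaSum_apply (f : FullShift d → ℝ) (c s : ℝ) {k : Set (FullShift d)}
    (hk : MeasurableSet k) :
    zetaSum f c s k = ∑' n : ℕ, ∑' x : Fix d (n + 1),
      ENNReal.ofReal (weight f c s (n + 1) x) * empiricalMeasure (n + 1) (x : FullShift d) k := by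
  simp [zetaSum, Measure.sum_apply _ hk]

theorem zetaSum_univ (f : FullShift d → ℝ) (c s : ℝ) :
    zetaSum f c s Set.univ = zetaNormalization f c s := by
  rw [zetaSum_apply f c s MeasurableSet.univ, zetaNormalization]
  refine tsum_congr fun n => tsum_congr fun x => ?_
  have := empiricalMeasure_isProbabilityMeasure n.succ_ne_zero (x : FullShift d)
  rw [measure_univ, mul_one]

theorem exists_mem_of_empiricalMeasure_ne_zero {n : ℕ} {x : FullShift d} {k : Set (FullShift d)}
    (hk : MeasurableSet k) (h : empiricalMeasure n x k ≠ 0) : ∃ i, shift^[i] x ∈ k := by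
  by_contra! hx
  refine h ?_
  simp [empiricalMeasure, Measure.finsetSum_apply, Measure.dirac_apply' _ hk, hx]

theorem inv_le_empiricalMeasure {n : ℕ} (hn : n ≠ 0) {x : FullShift d} {k : Set (FullShift d)}
    (hx : x ∈ k) : (n : ENNReal)⁻¹ ≤ empiricalMeasure n x k := by
  rw [empiricalMeasure, Measure.smul_apply, smul_eq_mul, Measure.finsetSum_apply]
  refine le_mul_of_one_le_right (zero_le) ?_
  refine le_trans ?_ (Finset.single_le_sum (f := fun i => Measure.dirac (shift^[i] x) k)
    (fun _ _ => zero_le) (Finset.mem_range.2 (Nat.pos_of_ne_zero hn)))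
  simp [Measure.dirac_apply_of_mem hx]

theorem tsum_Fix_exp_le [NeZero d] {θ C M : ℝ} {g : FullShift d → ℝ}
    (hg : BoundedDistortion θ C g) (hM : ∀ x, g x ≤ M) (hM0 : 0 ≤ M) {n : ℕ} (hn : n ≠ 0) :
    ∑' x : Fix d n, ENNReal.ofReal (Real.exp (birkhoffSum shift g n x))
      ≤ ENNReal.ofReal (Real.exp (n * pressure g + C)) := by
  let word : Fix d n → (Fin n → Fin d) := fun x i => (x : FullShift d) i
  have hinj : Function.Injective word := by
    intro x y hxy
    ext i
    have h : ∀ z : Fix d n, (z : FullShift d) i = (z : FullShift d) (i % n) := fun z =>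
      (periodize_apply_of_lt_add (m := i + 1) (fun l _ => mem_Fix_iff.1 z.2 l) (by omega)).symm
    rw [h x, h y]
    exact congrArg Fin.val (congrFun hxy ⟨i % n, Nat.mod_lt _ (Nat.pos_of_ne_zero hn)⟩)
  let S : (Fin n → Fin d) → ℝ := fun w => sSup ((fun x => Real.exp (birkhoffSum shift g n x)) ''
      {x : FullShift d | ∀ i : Fin n, x i = w i})
  have hS : ∀ w, 0 ≤ S w := fun w => Real.sSup_nonneg (by rintro _ ⟨y, -, rfl⟩; positivity)
  calc _ ≤ ∑' x : Fix d n, ENNReal.ofReal (S (word x)) :=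
        ENNReal.tsum_le_tsum fun x => ENNReal.ofReal_le_ofReal (exp_le_sSup hg fun i => rfl)
    _ ≤ ∑' w, ENNReal.ofReal (S w) :=
        ENNReal.tsum_comp_le_tsum_of_injective hinj fun w => ENNReal.ofReal (S w)
    _ = ENNReal.ofReal (partitionFunction g n) := by
        rw [tsum_fintype, ← ENNReal.ofReal_sum_of_nonneg fun w _ => hS w]; rfl
    _ ≤ _ := ENNReal.ofReal_le_ofReal (partitionFunction_le hg hM hM0 hn)

/-- Only a small fraction `η` of the energy `c f` is kept to control the number of orbits; the
remaining part is bounded by the cost `infRate f k`. -/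
theorem weight_le {f : FullShift d → ℝ} {M : ℝ} (hM : ∀ x, |f x| ≤ M) {fmin : ℝ}
    (hmin : ∀ x, fmin ≤ f x) {c s η : ℝ} (hc : 0 < c) (hs : 0 ≤ c * (1 - s)) (hη1 : η ≤ 1)
    {k : Set (FullShift d)} {n : ℕ} (hn : n ≠ 0) {x : FullShift d} (hx : x ∈ Fix d n) {i : ℕ}
    (hxk : shift^[i] x ∈ k) :
    weight f c s n x ≤ Real.exp (-((1 - η) * c * infRate f k) + (1 - η) * c * (n * maxAverage f)
        - c * (1 - s) * (n * fmin) - n * pressure fun y => c * f y)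
      * Real.exp (birkhoffSum shift (fun y => η * c * f y) n x) := by
  have h1 := infRate_le hM hn (shift_iterate_mem_Fix hx i) hxk
  rw [birkhoffSum_shift_iterate hx] at h1
  have h2 := mul_le_mul_of_nonneg_left h1 (mul_nonneg (sub_nonneg.2 hη1) hc.le)
  have h3 := mul_le_mul_of_nonneg_left (le_birkhoffSum hmin n x) hs
  rw [weight, ← Real.exp_add, birkhoffSum_const_mul]
  refine Real.exp_le_exp.2 ?_
  linarith

theorem zetaSum_le [NeZero d] {θ K : ℝ} {f : FullShift d → ℝ} {M : ℝ} (hM : ∀ x, |f x| ≤ M)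
    (hK : BoundedDistortion θ K f) {fmin : ℝ} (hmin : ∀ x, fmin ≤ f x) {c s η δ : ℝ}
    (hc : 0 < c) (hs : 0 ≤ c * (1 - s)) (hη0 : 0 < η) (hη1 : η ≤ 1) (hδ0 : 0 < δ)
    (hδ : δ ≤ c * (1 - s) * fmin - (excessPressure f (η * c) - excessPressure f c))
    {k : Set (FullShift d)} (hk : MeasurableSet k) :
    zetaSum f c s k ≤ ENNReal.ofReal
      (Real.exp (c * (-((1 - η) * infRate f k) + η * K)) * (1 - Real.exp (-δ))⁻¹) := by
  have hM0 : 0 ≤ M := (abs_nonneg _).trans (hM fun _ => 0)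
  have hηc : 0 < η * c := mul_pos hη0 hc
  have hr : Real.exp (-δ) < 1 := Real.exp_lt_one_iff.2 (by linarith)
  have hterm : ∀ n : ℕ, ∑' x : Fix d (n + 1), ENNReal.ofReal (weight f c s (n + 1) x)
      * empiricalMeasure (n + 1) (x : FullShift d) k
      ≤ ENNReal.ofReal (Real.exp (c * (-((1 - η) * infRate f k) + η * K)) * Real.exp (-δ) ^ n) := by
    intro n
    have hn := n.succ_ne_zero
    set a : ℝ := Real.exp (-((1 - η) * c * infRate f k)
        + (1 - η) * c * ((n + 1 : ℕ) * maxAverage f)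
        - c * (1 - s) * ((n + 1 : ℕ) * fmin) - (n + 1 : ℕ) * pressure fun y => c * f y) with ha
    have ha0 : 0 ≤ a := (Real.exp_pos _).le
    calc _ ≤ ∑' x : Fix d (n + 1), ENNReal.ofReal a * ENNReal.ofReal
            (Real.exp (birkhoffSum shift (fun y => η * c * f y) (n + 1) x)) := by
          refine ENNReal.tsum_le_tsum fun x => ?_
          by_cases h0 : empiricalMeasure (n + 1) (x : FullShift d) k = 0
          · rw [h0, mul_zero]; exact zero_le
          · obtain ⟨i, hi⟩ := exists_mem_of_empiricalMeasure_ne_zero hk h0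
            have := empiricalMeasure_isProbabilityMeasure hn (x : FullShift d)
            refine (mul_le_of_le_one_right (zero_le) prob_le_one).trans ?_
            rw [← ENNReal.ofReal_mul ha0]
            exact ENNReal.ofReal_le_ofReal (weight_le hM hmin hc hs hη1 hn x.2 hi)
      _ ≤ ENNReal.ofReal a * ENNReal.ofReal (Real.exp
            ((n + 1 : ℕ) * (pressure fun y => η * c * f y) + η * c * K)) := by
          rw [ENNReal.tsum_mul_left]
          gcongr
          exact tsum_Fix_exp_le (hK.const_mul hηc.le) (M := η * c * M) (fun x =>
            mul_le_mul_of_nonneg_left ((le_abs_self _).trans (hM x)) hηc.le) (by positivity) hn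
      _ ≤ _ := by
          rw [← ENNReal.ofReal_mul ha0, ha, ← Real.exp_add, ← Real.exp_nat_mul, ← Real.exp_add]
          refine ENNReal.ofReal_le_ofReal (Real.exp_le_exp.2 ?_)
          have h1 := mul_le_mul_of_nonneg_left hδ (Nat.cast_nonneg (α := ℝ) (n + 1))
          simp only [excessPressure] at h1
          push_cast at h1 ⊢
          linarith
  rw [zetaSum_apply f c s hk]
  refine (ENNReal.tsum_le_tsum hterm).trans ?_
  rw [← ENNReal.ofReal_tsum_of_nonneg (fun n => by positivity)
    ((summable_geometric_of_lt_one (Real.exp_pos _).le hr).mul_left _), tsum_mul_left,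
    tsum_geometric_of_lt_one (Real.exp_pos _).le hr]

theorem le_zetaSum (f : FullShift d → ℝ) (c s : ℝ) {k : Set (FullShift d)} (hk : MeasurableSet k)
    {x : FullShift d} (hx : x ∈ k ∩ Function.periodicPts shift) :
    ENNReal.ofReal (Real.exp (-(c * rate f x)
        - c * (1 - s) * birkhoffSum shift f (Function.minimalPeriod shift x) x
        - Function.minimalPeriod shift x * excessPressure f c) / Function.minimalPeriod shift x)
      ≤ zetaSum f c s k := by
  have hp := Function.minimalPeriod_pos_of_mem_periodicPts hx.2
  have hFix : x ∈ Fix d (Function.minimalPeriod shift x) :=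
    Function.isPeriodicPt_minimalPeriod shift x
  unfold rate
  generalize Function.minimalPeriod shift x = p at hp hFix
  obtain ⟨n, rfl⟩ := Nat.exists_eq_succ_of_ne_zero hp.ne'
  rw [Nat.succ_eq_add_one] at hFix ⊢
  rw [zetaSum_apply f c s hk]
  refine le_trans ?_ (ENNReal.le_tsum n)
  refine le_trans ?_ (ENNReal.le_tsum ⟨x, hFix⟩)
  rw [ENNReal.ofReal_div_of_pos (by positivity), ENNReal.ofReal_natCast, div_eq_mul_inv]
  gcongr
  · refine le_of_eq (congrArg Real.exp ?_)
    simp only [excessPressure]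
    ring
  · exact inv_le_empiricalMeasure n.succ_ne_zero hx.1

/-! ### The large deviation limit -/

theorem cylinder_inter_periodicPts_nonempty (a : FullShift d) (m : ℕ) :
    (PiNat.cylinder a m ∩ Function.periodicPts shift).Nonempty := by
  refine ⟨periodize (m + 1) a, PiNat.mem_cylinder_iff.2 fun i hi => ?_,
    m + 1, m.succ_pos, periodize_mem_Fix _ a⟩
  exact periodize_apply_of_lt_add (m := 0) (by simp) (by omega)

theorem exists_eventually_lt {ι : Type*} {l : Filter ι} {u : ι → ℝ} {L : EReal} (hL : 0 < L)
    (hu : Tendsto (fun i => (u i : EReal)) l (𝓝 L) ∨ liminf (fun i => (u i : EReal)) l = L) :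
    ∃ r : ℝ, 0 < r ∧ ∀ᶠ i in l, r < u i := by
  obtain ⟨r, hr0, hrL⟩ := EReal.lt_iff_exists_real_btwn.1 hL
  refine ⟨r, by exact_mod_cast hr0, ?_⟩
  have : ∀ᶠ i in l, (r : EReal) < u i := by
    rcases hu with hu | hu
    · exact hu.eventually (lt_mem_nhds hrL)
    · exact eventually_lt_of_lt_liminf (hu ▸ hrL)
  filter_upwards [this] with i hi
  exact_mod_cast hi

theorem tendsto_log_zetaSum [NeZero d] {θ K : ℝ} {f : FullShift d → ℝ} (hf : Continuous f)
    {M : ℝ} (hM : ∀ x, |f x| ≤ M) (hK : BoundedDistortion θ K f) {fmin : ℝ} (hmin0 : 0 < fmin)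
    (hmin : ∀ x, fmin ≤ f x) {ι : Type*} {l : Filter ι} {c s : ι → ℝ} (hc : Tendsto c l atTop)
    (hs : Tendsto s l (𝓝 1)) {r : ℝ} (hr : 0 < r) (hcs : ∀ᶠ i in l, r < c i * (1 - s i))
    {k : Set (FullShift d)} (hk : MeasurableSet k)
    (hne : (k ∩ Function.periodicPts shift).Nonempty) :
    (∀ᶠ i in l, 0 < (zetaSum f (c i) (s i)).real k) ∧
    Tendsto (fun i => 1 / c i * Real.log ((zetaSum f (c i) (s i)).real k)) l
      (𝓝 (-infRate f k)) := by
  have hinv : Tendsto (fun i => (c i)⁻¹) l (𝓝 0) := tendsto_inv_atTop_zero.comp hc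
  -- upper bounds, for each fixed fraction `η`
  have hupper : ∀ η : ℝ, 0 < η → η ≤ 1 → ∀ᶠ i in l, 0 < c i ∧ zetaSum f (c i) (s i) k
      ≤ ENNReal.ofReal (Real.exp (c i * (-((1 - η) * infRate f k) + η * K))
        * (1 - Real.exp (-(r * fmin / 2)))⁻¹) := by
    intro η hη0 hη1
    have hex := (tendsto_excessPressure_sub hf hM hK hη0).comp hc
    filter_upwards [hcs, hc.eventually_gt_atTop 0,
      hex.eventually (gt_mem_nhds (show 0 < r * fmin / 2 by positivity))] with i h1 h2 h3
    refine ⟨h2, zetaSum_le hM hK hmin h2 (by linarith) hη0 hη1 (by positivity) ?_ hk⟩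
    have := mul_le_mul_of_nonneg_right h1.le hmin0.le
    simp only [Function.comp_apply] at h3
    linarith
  have hfin : ∀ᶠ i in l, zetaSum f (c i) (s i) k ≠ ⊤ := by
    filter_upwards [hupper 1 one_pos le_rfl] with i hi
    exact (hi.2.trans_lt ENNReal.ofReal_lt_top).ne
  have hlower : ∀ x ∈ k ∩ Function.periodicPts shift, ∀ᶠ i in l,
      Real.exp (-(c i * rate f x)
        - c i * (1 - s i) * birkhoffSum shift f (Function.minimalPeriod shift x) x
        - Function.minimalPeriod shift x * excessPressure f (c i)) / Function.minimalPeriod shift x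
      ≤ (zetaSum f (c i) (s i)).real k := by
    intro x hx
    filter_upwards [hfin] with i hi
    exact (ENNReal.ofReal_le_iff_le_toReal hi).1 (le_zetaSum f (c i) (s i) hk hx)
  have hpos : ∀ᶠ i in l, 0 < (zetaSum f (c i) (s i)).real k := by
    obtain ⟨x, hx⟩ := hne
    have hp := Function.minimalPeriod_pos_of_mem_periodicPts hx.2
    filter_upwards [hlower x hx] with i hi
    exact lt_of_lt_of_le (by positivity) hi
  refine ⟨hpos, tendsto_order.2 ⟨fun b hb => ?_, fun b hb => ?_⟩⟩
  · obtain ⟨_, ⟨x, hx, rfl⟩, hxb⟩ :=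
      exists_lt_of_csInf_lt (hne.image _) (show infRate f k < -b by linarith)
    have hp := Function.minimalPeriod_pos_of_mem_periodicPts hx.2
    have hlow := hlower x hx
    generalize Function.minimalPeriod shift x = p at hp hlow
    have hp' : (0 : ℝ) < p := by exact_mod_cast hp
    have hlim : Tendsto (fun i => -rate f x - (1 - s i) * birkhoffSum shift f p x
        - (c i)⁻¹ * (p * excessPressure f 1 + Real.log p)) l
        (𝓝 (-rate f x - (1 - 1) * birkhoffSum shift f p x
          - 0 * (p * excessPressure f 1 + Real.log p))) :=
      (tendsto_const_nhds.sub ((tendsto_const_nhds.sub hs).mul_const _)).sub (hinv.mul_const _)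
    filter_upwards [hlow, hc.eventually_ge_atTop 1,
      hlim.eventually (lt_mem_nhds (show b < _ by linarith))] with i h1 h2 h3
    have hci : 0 < c i := by linarith
    refine h3.trans_le ?_
    have hlog := Real.log_le_log (by positivity) h1
    rw [Real.log_div (Real.exp_pos _).ne' hp'.ne', Real.log_exp] at hlog
    have hanti := mul_le_mul_of_nonneg_left (excessPressure_anti hM hK one_pos h2) hp'.le
    rw [one_div, le_inv_mul_iff₀ hci]
    have hc1 : c i * (c i)⁻¹ = 1 := mul_inv_cancel₀ hci.ne'
    calc c i * (-rate f x - (1 - s i) * birkhoffSum shift f p x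
          - (c i)⁻¹ * (p * excessPressure f 1 + Real.log p))
        = -(c i * rate f x) - c i * (1 - s i) * birkhoffSum shift f p x
          - (c i * (c i)⁻¹) * (p * excessPressure f 1 + Real.log p) := by ring
      _ ≤ _ := by rw [hc1]; linarith
  · have hη : ∀ᶠ η : ℝ in 𝓝[>] 0, -((1 - η) * infRate f k) + η * K < b := by
      have : Tendsto (fun η : ℝ => -((1 - η) * infRate f k) + η * K) (𝓝 0)
          (𝓝 (-((1 - 0) * infRate f k) + 0 * K)) := by
        apply Continuous.tendsto
        fun_prop
      exact (this.mono_left nhdsWithin_le_nhds).eventually (gt_mem_nhds (by linarith))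
    obtain ⟨η, hηb, hη0, hη1⟩ := (hη.and (Ioc_mem_nhdsGT (zero_lt_one' ℝ))).exists
    set q := Real.log ((1 - Real.exp (-(r * fmin / 2)))⁻¹)
    have hq : 0 < (1 - Real.exp (-(r * fmin / 2)))⁻¹ :=
      inv_pos.2 (sub_pos.2 (Real.exp_lt_one_iff.2 (by linarith [mul_pos hr hmin0])))
    have hlim : Tendsto (fun i => -((1 - η) * infRate f k) + η * K + (c i)⁻¹ * q) l
        (𝓝 (-((1 - η) * infRate f k) + η * K + 0 * q)) :=
      tendsto_const_nhds.add (hinv.mul_const _)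
    filter_upwards [hupper η hη0 hη1, hpos,
      hlim.eventually (gt_mem_nhds (show _ < b by linarith))] with i h1 h2 h3
    refine lt_of_le_of_lt ?_ h3
    have hle := Real.log_le_log h2
      (ENNReal.toReal_le_of_le_ofReal (by positivity) h1.2)
    rw [Real.log_mul (Real.exp_pos _).ne' hq.ne', Real.log_exp] at hle
    rw [one_div, inv_mul_le_iff₀ h1.1]
    refine hle.trans_eq ?_
    rw [mul_add _ _ ((c i)⁻¹ * q), mul_inv_cancel_left₀ h1.1.ne']

end ZetaLDP

theorem theorem4 (d : ℕ) (hd : 0 < d) (θ : ℝ) (hθ0 : 0 < θ) (hθ1 : θ < 1)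
    (f : ZetaLDP.FullShift d → ℝ) (hf : ZetaLDP.IsLipschitz θ f) (hpos : ∀ x, 0 < f x)
    (L : EReal) (hL : 0 < L)
    {ι : Type*} (l : Filter ι) (c s : ι → ℝ)
    (hc : Tendsto c l atTop) (hs : Tendsto s l (𝓝 1))
    (hcs : Tendsto (fun i => ((c i * (1 - s i) : ℝ) : EReal)) l (𝓝 L) ∨
      liminf (fun i => ((c i * (1 - s i) : ℝ) : EReal)) l = L)
    (a : ZetaLDP.FullShift d) (m : ℕ) :
    Tendsto
      (fun i => (1 / c i) *
        Real.log ((ZetaLDP.zetaMeasure f (c i) (s i)).real (PiNat.cylinder a m)))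
      l (𝓝 (-ZetaLDP.infRate f (PiNat.cylinder a m))) := by
  have : NeZero d := ⟨hd.ne'⟩
  have hcont := hf.continuous hθ0 hθ1
  obtain ⟨K, -, hK⟩ := hf.exists_boundedDistortion hθ0 hθ1
  obtain ⟨x₀, -, hx₀⟩ := isCompact_univ.exists_isMinOn Set.univ_nonempty hcont.continuousOn
  obtain ⟨x₁, -, hx₁⟩ := isCompact_univ.exists_isMaxOn Set.univ_nonempty hcont.continuousOn
  have hmin : ∀ x, f x₀ ≤ f x := fun x => hx₀ (Set.mem_univ x)
  have hM : ∀ x, |f x| ≤ f x₁ := fun x => by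
    rw [abs_of_pos (hpos x)]; exact hx₁ (Set.mem_univ x)
  obtain ⟨r, hr, hcs'⟩ := ZetaLDP.exists_eventually_lt hL hcs
  obtain ⟨hp1, ht1⟩ := ZetaLDP.tendsto_log_zetaSum hcont hM hK (hpos x₀) hmin hc hs hr hcs'
    (PiNat.isOpen_cylinder _ a m).measurableSet (ZetaLDP.cylinder_inter_periodicPts_nonempty a m)
  obtain ⟨hp0, ht0⟩ := ZetaLDP.tendsto_log_zetaSum hcont hM hK (hpos x₀) hmin hc hs hr hcs'
    MeasurableSet.univ
    ((ZetaLDP.cylinder_inter_periodicPts_nonempty a 0).mono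
      (Set.inter_subset_inter_left _ (Set.subset_univ _)))
  have ht := ht1.sub ht0
  rw [ZetaLDP.infRate_univ hθ0 hθ1 hcont hM hK, neg_zero, sub_zero] at ht
  refine ht.congr' ?_
  filter_upwards [hp1, hp0] with i h1 h0
  have hdiv : (ZetaLDP.zetaMeasure f (c i) (s i)).real (PiNat.cylinder a m)
      = ((ZetaLDP.zetaSum f (c i) (s i)).real Set.univ)⁻¹
        * (ZetaLDP.zetaSum f (c i) (s i)).real (PiNat.cylinder a m) := by
    rw [Measure.real, Measure.real, Measure.real, ZetaLDP.zetaSum_univ, ← ENNReal.toReal_inv,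
      ← ENNReal.toReal_mul]
    rfl
  rw [hdiv, Real.log_mul (inv_ne_zero h0.ne') h1.ne', Real.log_inv]
  ring
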